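/- For a finite simple graph $X$ with adjacency matrix $A$ let $U(t)=\exp(itA)$, $t\in\mathbb{R}$. Perfect state transfer (PST) occurs between vertices $x,y$ of $X$ at time $\tau>0$ if $|U(\tau)_{x,y}|=1$, and PST occurs between $x$ and $y$ if it does so at some time $\tau>0$. A vertex $x$ is periodic if $|U(\tau)_{x,x}|=1$ for some $\tau>0$. Pretty good state transfer (PGST) occurs between $x$ and $y$ if there is a sequence of real numbers $\tau_j$ with $\lim_{j\to\infty}|U(\tau_j)_{x,y}|=1$; it is proper if $x$ and $y$ are not periodic. The $2$-fold blow-up of a graph $G$ with vertex set $V$ is the graph on $\mathbb{Z}_2\times V$ in which $(l,v)$ and $(l',v')$ are adjacent if and only if $v$ and $v'$ are adjacent in $G$. For a nonzero integer $a$, let $\nu_2(a)$ be the exponent of the largest power of $2$ dividing $a$. Let $H$ be a $k$-regular simple graph on $m\ge 1$ vertices, and let $G$ be the cone on $H$ with apex $u$, that is, the graph obtained from $H$ by adding a new vertex $u$ adjacent to all vertices of $H$. Then, in the $2$-fold blow-up of $G$: 1. PST occurs between $(0,u)$ and $(1,u)$ if and only if either (i) $k=0$, or (ii) $k>0$ and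 $m=\frac14 s(2k+s)$ for some even integer $s$ with $\nu_2(2k)>\nu_2(s)$. Moreover, the least time $\tau>0$ at which PST occurs between $(0,u)$ and $(1,u)$ is $\tau=\frac{\pi}{2\sqrt m}$ in case (i), and $\tau=\frac{\pi}{\gcd(2k,s)}$ in case (ii), for every $s$ as in (ii). 2. Proper PGST occurs between $(0,u)$ and $(1,u)$ if and only if $k>0$ and $k^2+4m$ is not a perfect square. -/

import Mathlib

open scoped Matrix

namespace QuantumWalk

/-- The cone on a graph `H`: the vertices of `H` (as `some w`) together with one new vertex,
the apex `none`, which is adjacent to every vertex of `H`. -/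
def cone {W : Type*} (H : SimpleGraph W) : SimpleGraph (Option W) where
  Adj
    | none, none => False
    | none, some _ => True
    | some _, none => True
    | some v, some w => H.Adj v w
  symm := ⟨by rintro (_ | v) (_ | w) h <;> first | exact h | exact h.symm⟩
  loopless := ⟨by rintro (_ | v) h <;> first | exact h | exact H.irrefl h⟩

instance {W : Type*} (H : SimpleGraph W) [DecidableRel H.Adj] : DecidableRel (cone H).Adj
  | none, none => inferInstanceAs (Decidable False)
  | none, some _ => inferInstanceAs (Decidable True)
  | some _, none => inferInstanceAs (Decidable True)
  | some v, some w => inferInstanceAs (Decidable (H.Adj v w))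

/-- The blow-up of `n` copies of `G`: the vertex set is `ℤ/n × V`, and `(l, u)` is adjacent
to `(m, v)` if and only if `u` is adjacent to `v` in `G`. -/
def blowUp {V : Type*} (n : ℕ) (G : SimpleGraph V) : SimpleGraph (ZMod n × V) where
  Adj x y := G.Adj x.2 y.2
  symm := ⟨fun _ _ h => G.adj_symm h⟩
  loopless := ⟨fun _ h => G.irrefl h⟩

instance {V : Type*} (n : ℕ) (G : SimpleGraph V) [DecidableRel G.Adj] :
    DecidableRel (blowUp n G).Adj :=
  fun x y => inferInstanceAs (Decidable (G.Adj x.2 y.2))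

section Walk

variable {V : Type*} [Fintype V] [DecidableEq V] (G : SimpleGraph V) [DecidableRel G.Adj]

/-- The transition matrix `U(t) = exp(i t A)` of the continuous-time quantum walk on `G`,
where `A` is the adjacency matrix of `G`. -/
noncomputable def transitionMatrix (t : ℝ) : Matrix V V ℂ :=
  NormedSpace.exp ((Complex.I * (t : ℂ)) • G.adjMatrix ℂ)

/-- Perfect state transfer between `x` and `y` at time `τ > 0`. -/
def HasPSTAt (x y : V) (τ : ℝ) : Prop :=
  0 < τ ∧ ‖transitionMatrix G τ x y‖ = 1

/-- Perfect state transfer between `x` and `y` (at some time). -/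
def HasPST (x y : V) : Prop :=
  ∃ τ : ℝ, HasPSTAt G x y τ

/-- The vertex `x` is periodic: `|U(τ)_{x,x}| = 1` for some `τ > 0`. -/
def IsPeriodicAt (x : V) : Prop :=
  ∃ τ : ℝ, 0 < τ ∧ ‖transitionMatrix G τ x x‖ = 1

/-- Pretty good state transfer between `x` and `y`. -/
def HasPGST (x y : V) : Prop :=
  ∃ τ : ℕ → ℝ,
    Filter.Tendsto (fun j => ‖transitionMatrix G (τ j) x y‖) Filter.atTop (nhds 1)

/-- Proper pretty good state transfer: pretty good state transfer between vertices that are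
not periodic. -/
def HasProperPGST (x y : V) : Prop :=
  HasPGST G x y ∧ ¬ IsPeriodicAt G x ∧ ¬ IsPeriodicAt G y

end Walk

end QuantumWalk

namespace QuantumWalk

/-! ### Exponentials on eigenvectors and extremal sums of phases -/

open Complex

/-! The blow-up has adjacency matrix `J ⊗ A`, with `J` the all-ones matrix of order 2. An apex state
is a combination of an antisymmetric null vector and two eigenvectors with eigenvalues `k ± D`,
where `D ^ 2 = k ^ 2 + 4m`. The amplitude is therefore `(a e^{i(k+D)t} + b e^{i(k-D)t} ± 1) / 2`
with `a, b > 0`, `a + b = 1` (`transitionMatrix_blowUp_cone_apex`). By strict convexity it has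
modulus 1 only if both phases equal -1 (transfer) or both equal 1 (periodicity).

So PST at `t` means that `(k ± D)t` are odd multiples of `π`. For `k > 0` this makes `D` rational,
hence an integer; with `s = D - k`, parity becomes a comparison of 2-adic valuations, and Bézout
gives the least time. If `k > 0` and `D` is irrational, a density argument makes both phases
approach -1, while exact periodicity would make `D` rational. -/

theorem exp_mulVec_of_mulVec_eq_smul {ι : Type*} [Fintype ι] [DecidableEq ι]
    {M : Matrix ι ι ℂ} {v : ι → ℂ} {μ : ℂ} (h : M *ᵥ v = μ • v) :
    NormedSpace.exp M *ᵥ v = Complex.exp μ • v := by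
  let : NormedRing (Matrix ι ι ℂ) := Matrix.linftyOpNormedRing
  let : NormedAlgebra ℂ (Matrix ι ι ℂ) := Matrix.linftyOpNormedAlgebra
  have hpow : ∀ n : ℕ, (M ^ n) *ᵥ v = μ ^ n • v := by
    intro n
    induction n with
    | zero => simp
    | succ n ih => rw [pow_succ, ← Matrix.mulVec_mulVec, h, Matrix.mulVec_smul, ih, smul_smul,
        pow_succ, mul_comm]
  have h1 := NormedSpace.exp_series_hasSum_exp' (𝕂 := ℂ) M
  have h2 := NormedSpace.exp_series_hasSum_exp' (𝕂 := ℂ) μ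
  have hc : Continuous fun N : Matrix ι ι ℂ => N *ᵥ v := by fun_prop
  have h3 := h1.map (Matrix.mulVecBilin ℂ ℂ |>.flip v : Matrix ι ι ℂ →ₗ[ℂ] (ι → ℂ)) hc
  have h4 := h2.smul_const v
  rw [Complex.exp_eq_exp_ℂ]
  refine h3.unique ?_
  convert h4 using 1
  funext n
  simp [hpow, smul_smul]

/-- In the closed unit disc only -1 lies at distance 2 from 1, and it is an extreme point. In
coordinates: the real part of the combination is at most -1, while `z.re` and `w.re` are at least
-1. -/
theorem eq_neg_one_of_norm_convex_sub_one {a b : ℝ} (ha : 0 < a) (hb : 0 < b) (hab : a + b = 1)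
    {z w : ℂ} (hz : ‖z‖ = 1) (hw : ‖w‖ = 1) (h : ‖a * z + b * w - 1‖ = 2) :
    z = -1 ∧ w = -1 := by
  have hF : ‖a * z + b * w‖ ≤ 1 := by
    refine (norm_add_le _ _).trans ?_
    simp [hz, hw, abs_of_pos ha, abs_of_pos hb, hab]
  have e1 := Complex.sq_norm (a * z + b * w - 1)
  have e2 := Complex.sq_norm (a * z + b * w)
  have e3 := Complex.sq_norm z
  have e4 := Complex.sq_norm w
  rw [h] at e1
  rw [hz] at e3
  rw [hw] at e4
  have hF2 : ‖a * z + b * w‖ ^ 2 ≤ 1 := pow_le_one₀ (norm_nonneg _) hF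
  rw [e2] at hF2
  simp only [Complex.normSq_apply, Complex.sub_re, Complex.sub_im, Complex.one_re,
    Complex.one_im] at e1 e3 e4 hF2
  have hre : (a * z + b * w).re = a * z.re + b * w.re := by simp
  have hle : a * z.re + b * w.re ≤ -1 := by rw [← hre]; nlinarith
  have hz1 : -1 ≤ z.re := by nlinarith [mul_self_nonneg z.im]
  have hw1 : -1 ≤ w.re := by nlinarith [mul_self_nonneg w.im]
  have hz2 : z.re = -1 := by
    refine le_antisymm ?_ hz1
    by_contra! hlt
    nlinarith [mul_lt_mul_of_pos_left hlt ha, mul_le_mul_of_nonneg_left hw1 hb.le]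
  have hw2 : w.re = -1 := by
    refine le_antisymm ?_ hw1
    by_contra! hlt
    nlinarith [mul_lt_mul_of_pos_left hlt hb, mul_le_mul_of_nonneg_left hz1 ha.le]
  rw [hz2] at e3
  rw [hw2] at e4
  have hz3 : z.im = 0 := by
    have : z.im * z.im = 0 := by linarith
    exact mul_self_eq_zero.mp this
  have hw3 : w.im = 0 := by
    have : w.im * w.im = 0 := by linarith
    exact mul_self_eq_zero.mp this
  exact ⟨Complex.ext (by simp [hz2]) (by simp [hz3]), Complex.ext (by simp [hw2]) (by simp [hw3])⟩

theorem exp_I_mul_eq_one_iff {x : ℝ} :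
    Complex.exp (I * x) = 1 ↔ ∃ n : ℤ, x = 2 * n * Real.pi := by
  rw [Complex.exp_eq_one_iff]
  refine exists_congr fun n => ?_
  have : (n : ℂ) * (2 * Real.pi * I) = I * ((2 * n * Real.pi : ℝ) : ℂ) := by push_cast; ring
  rw [this, mul_right_inj' I_ne_zero, Complex.ofReal_inj]

theorem exp_I_mul_eq_neg_one_iff {x : ℝ} :
    Complex.exp (I * x) = -1 ↔ ∃ n : ℤ, x = (2 * n + 1) * Real.pi := by
  have : Complex.exp (I * x) = -Complex.exp (I * ((x - Real.pi : ℝ) : ℂ)) := by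
    have h : I * (x : ℂ) = I * ((x - Real.pi : ℝ) : ℂ) + Real.pi * I := by push_cast; ring
    rw [h, Complex.exp_add, Complex.exp_pi_mul_I]; ring
  rw [this, neg_inj, exp_I_mul_eq_one_iff]
  refine exists_congr fun n => ?_
  constructor <;> intro h <;> linarith

theorem blowUp_adj {V : Type*} {n : ℕ} {G : SimpleGraph V} {x y : ZMod n × V} :
    (blowUp n G).Adj x y ↔ G.Adj x.2 y.2 :=
  Iff.rfl

theorem cone_adj_none_some {W : Type*} {H : SimpleGraph W} {w : W} :
    (cone H).Adj none (some w) :=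
  trivial

theorem cone_adj_some_none {W : Type*} {H : SimpleGraph W} {w : W} :
    (cone H).Adj (some w) none :=
  trivial

theorem cone_adj_some_some {W : Type*} {H : SimpleGraph W} {v w : W} :
    (cone H).Adj (some v) (some w) ↔ H.Adj v w :=
  Iff.rfl

/-! ### Eigenvectors of the doubled cone and apex amplitudes -/

section Cone

variable {W : Type*} [Fintype W] [DecidableEq W] (H : SimpleGraph W) [DecidableRel H.Adj]

theorem adjMatrix_blowUp_mulVec {V : Type*} [Fintype V] [DecidableEq V] (G : SimpleGraph V)
    [DecidableRel G.Adj] (g : ZMod 2 → ℂ) (h : V → ℂ) (x : ZMod 2 × V) :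
    ((blowUp 2 G).adjMatrix ℂ *ᵥ fun y => g y.1 * h y.2) x
      = (g 0 + g 1) * (G.adjMatrix ℂ *ᵥ h) x.2 := by
  have hs : ∀ f : ZMod 2 → ℂ, ∑ l, f l = f 0 + f 1 := fun f => Fin.sum_univ_two f
  simp only [Matrix.mulVec, dotProduct, Fintype.sum_prod_type, hs, SimpleGraph.adjMatrix_apply,
    blowUp_adj, Finset.mul_sum, add_mul, ← Finset.sum_add_distrib]
  refine Finset.sum_congr rfl fun y _ => ?_
  ring

omit [DecidableEq W] in
theorem adjMatrix_cone_mulVec {k : ℕ} (hk : H.IsRegularOfDegree k) {l : ℂ}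
    (hl : l * (l - k) = Fintype.card W) :
    (cone H).adjMatrix ℂ *ᵥ (fun o => o.elim (l - k) fun _ => 1)
      = l • fun o => o.elim (l - k) fun _ => 1 := by
  funext o
  rcases o with _ | w
  · simp [Matrix.mulVec, dotProduct, Fintype.sum_option, SimpleGraph.adjMatrix_apply,
      cone_adj_none_some, hl]
  · have : ∑ x, (if H.Adj w x then (1 : ℂ) else 0) = k := by
      rw [Finset.sum_boole, ← hk w, ← SimpleGraph.card_neighborFinset_eq_degree,
        SimpleGraph.neighborFinset_eq_filter]
    simp [Matrix.mulVec, dotProduct, Fintype.sum_option, SimpleGraph.adjMatrix_apply,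
      cone_adj_some_none, cone_adj_some_some, this]

/-- The amplitudes of the walk on the doubled cone between copies of the apex; here `D` is the
difference of the two main eigenvalues of the cone. -/
theorem transitionMatrix_blowUp_cone_apex {k : ℕ} (hk : H.IsRegularOfDegree k) {D : ℝ}
    (hD : D ≠ 0) (hD2 : D ^ 2 = k ^ 2 + 4 * Fintype.card W) (t : ℝ) (i j : ZMod 2) :
    transitionMatrix (blowUp 2 (cone H)) t (i, none) (j, none)
      = (((D - k) / (2 * D) : ℝ) * Complex.exp (I * ((k + D) * t : ℝ))
        + ((D + k) / (2 * D) : ℝ) * Complex.exp (I * ((k - D) * t : ℝ))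
        + if i = j then 1 else -1) / 2 := by
  have hDC : (D : ℂ) ≠ 0 := by exact_mod_cast hD
  have hD2C : (D : ℂ) ^ 2 = k ^ 2 + 4 * Fintype.card W := by exact_mod_cast hD2
  set v : ℂ → ZMod 2 × Option W → ℂ :=
    fun l y => (fun _ : ZMod 2 => (1 : ℂ)) y.1 * (y.2.elim (l - k) fun _ => 1) with hv
  set v0 : ZMod 2 × Option W → ℂ :=
    fun y => (fun i => if i = j then 1 else -1 : ZMod 2 → ℂ) y.1 * (y.2.elim 1 fun _ => 0) with hv0
  have key : ∀ l : ℂ, l * (l - k) = Fintype.card W →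
      transitionMatrix (blowUp 2 (cone H)) t *ᵥ v l = Complex.exp (I * t * (2 * l)) • v l := by
    intro l hl
    refine exp_mulVec_of_mulVec_eq_smul ?_
    rw [Matrix.smul_mulVec, mul_smul _ (2 * l)]
    congr 1
    funext x
    refine (adjMatrix_blowUp_mulVec (cone H) (fun _ => 1)
      (fun o => o.elim (l - k) fun _ => 1) x).trans ?_
    rw [adjMatrix_cone_mulVec H hk hl]
    simp only [hv, Pi.smul_apply, smul_eq_mul]
    ring
  have key0 : transitionMatrix (blowUp 2 (cone H)) t *ᵥ v0 = v0 := by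
    have : Complex.exp 0 • v0 = v0 := by simp
    rw [← this]
    conv_lhs => rw [this]
    refine exp_mulVec_of_mulVec_eq_smul ?_
    rw [Matrix.smul_mulVec, zero_smul]
    convert smul_zero _
    funext x
    refine (adjMatrix_blowUp_mulVec (cone H) (fun i => if i = j then 1 else -1)
      (fun o => o.elim 1 fun _ => 0) x).trans ?_
    have : ∀ j : ZMod 2, ((if 0 = j then (1 : ℂ) else -1) + if 1 = j then (1 : ℂ) else -1) = 0 := by
      intro j
      obtain rfl | rfl : j = 0 ∨ j = 1 := by decide +revert
      all_goals simp
    simp [this]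
  set lp : ℂ := (k + D) / 2 with hlp
  set lm : ℂ := (k - D) / 2 with hlm
  have hp := key lp (by rw [hlp]; linear_combination hD2C / 4)
  have hm := key lm (by rw [hlm]; linear_combination hD2C / 4)
  -- The vectors `v lp` and `v lm` agree off the apex and differ there by `D` in both layers; `v0`
  -- then separates the layers.
  have hsingle : Pi.single (j, none) 1 = (1 / 2 : ℂ) • v0 + (1 / (2 * D) : ℂ) • (v lp - v lm) := by
    funext ⟨i, o⟩
    rcases o with _ | w
    · by_cases hij : i = j
      · subst hij
        simp [hv, hv0, hlp, hlm]
        field_simp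
        ring
      · simp [hv, hv0, hlp, hlm, hij]
        field_simp
        ring
    · simp [hv, hv0]
  have hcol : transitionMatrix (blowUp 2 (cone H)) t (i, none) (j, none)
      = (transitionMatrix (blowUp 2 (cone H)) t *ᵥ Pi.single (j, none) 1) (i, none) := by simp
  have e1 : I * t * (2 * lp) = I * ((k + D) * t : ℝ) := by rw [hlp]; push_cast; ring
  have e2 : I * t * (2 * lm) = I * ((k - D) * t : ℝ) := by rw [hlm]; push_cast; ring
  rw [hcol, hsingle, Matrix.mulVec_add, Matrix.mulVec_smul, Matrix.mulVec_smul, Matrix.mulVec_sub,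
    hp, hm, key0, e1, e2]
  simp only [hv, hv0, hlp, hlm, Pi.add_apply, Pi.smul_apply, Pi.sub_apply, smul_eq_mul,
    Option.elim_none]
  push_cast
  field_simp
  ring

end Cone

/-- Strictness keeps both weights `(D ± k) / (2D)` positive. -/
theorem lt_of_sq_eq_add {k m : ℕ} (hm : 0 < m) {D : ℝ} (hD0 : 0 ≤ D)
    (hD2 : D ^ 2 = k ^ 2 + 4 * m) : (k : ℝ) < D := by
  have : (0 : ℝ) < m := by exact_mod_cast hm
  exact lt_of_pow_lt_pow_left₀ 2 hD0 (by linarith)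

/-! ### Phase criteria for transfer and periodicity -/

section Apex

variable {W : Type*} [Fintype W] [DecidableEq W] [Nonempty W] (H : SimpleGraph W)
  [DecidableRel H.Adj] {k : ℕ} (hk : H.IsRegularOfDegree k) {D : ℝ} (hD0 : 0 ≤ D)
  (hD2 : D ^ 2 = k ^ 2 + 4 * Fintype.card W)

include hk hD0 hD2

theorem hasPSTAt_apex_iff {t : ℝ} :
    HasPSTAt (blowUp 2 (cone H)) (0, none) (1, none) t ↔
      0 < t ∧ (∃ n : ℤ, (k + D) * t = (2 * n + 1) * Real.pi) ∧
        ∃ n : ℤ, (k - D) * t = (2 * n + 1) * Real.pi := by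
  have hkD := lt_of_sq_eq_add Fintype.card_pos hD0 hD2
  have hD : 0 < D := (Nat.cast_nonneg k).trans_lt hkD
  have hk0 : (0 : ℝ) ≤ k := Nat.cast_nonneg k
  rw [HasPSTAt, transitionMatrix_blowUp_cone_apex H hk hD.ne' hD2, if_neg zero_ne_one,
    ← exp_I_mul_eq_neg_one_iff, ← exp_I_mul_eq_neg_one_iff, norm_div, ← sub_eq_add_neg]
  refine and_congr_right fun _ => ⟨fun h => ?_, fun h => ?_⟩
  · refine eq_neg_one_of_norm_convex_sub_one (a := (D - k) / (2 * D)) (b := (D + k) / (2 * D))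
      (div_pos (by linarith) (by linarith)) (div_pos (by linarith) (by linarith))
      (by field_simp; ring) (norm_exp_I_mul_ofReal _) (norm_exp_I_mul_ofReal _) ?_
    rw [Complex.norm_ofNat] at h
    linarith
  · rw [h.1, h.2]
    have hDC : (D : ℂ) ≠ 0 := by exact_mod_cast hD.ne'
    have : (((D - k) / (2 * D) : ℝ) : ℂ) * -1 + ((D + k) / (2 * D) : ℝ) * -1 - 1 = -2 := by
      push_cast
      field_simp
      ring
    rw [this]
    simp

theorem isPeriodicAt_apex_iff (i : ZMod 2) :
    IsPeriodicAt (blowUp 2 (cone H)) (i, none) ↔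
      ∃ t : ℝ, 0 < t ∧ (∃ n : ℤ, (k + D) * t = 2 * n * Real.pi) ∧
        ∃ n : ℤ, (k - D) * t = 2 * n * Real.pi := by
  have hkD := lt_of_sq_eq_add Fintype.card_pos hD0 hD2
  have hD : 0 < D := (Nat.cast_nonneg k).trans_lt hkD
  have hk0 : (0 : ℝ) ≤ k := Nat.cast_nonneg k
  refine exists_congr fun t => ?_
  rw [transitionMatrix_blowUp_cone_apex H hk hD.ne' hD2, if_pos rfl,
    ← exp_I_mul_eq_one_iff, ← exp_I_mul_eq_one_iff, norm_div]
  refine and_congr_right fun _ => ⟨fun h => ?_, fun h => ?_⟩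
  -- Negating both phases reduces the sum with +1 to the extremal lemma with -1.
  · rw [← neg_inj, ← neg_inj (a := Complex.exp (I * ((k - D) * t : ℝ)))]
    refine eq_neg_one_of_norm_convex_sub_one (a := (D - k) / (2 * D)) (b := (D + k) / (2 * D))
      (div_pos (by linarith) (by linarith)) (div_pos (by linarith) (by linarith))
      (by field_simp; ring) (by rw [norm_neg, norm_exp_I_mul_ofReal])
      (by rw [norm_neg, norm_exp_I_mul_ofReal]) ?_
    rw [Complex.norm_ofNat] at h
    rw [← norm_neg]
    ring_nf at h ⊢
    linarith
  · rw [h.1, h.2]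
    have hDC : (D : ℂ) ≠ 0 := by exact_mod_cast hD.ne'
    have : (((D - k) / (2 * D) : ℝ) : ℂ) * 1 + ((D + k) / (2 * D) : ℝ) * 1 + 1 = 2 := by
      push_cast
      field_simp
      ring
    rw [this]
    simp

/-- At times `(2p + 1)π / (k + D)` the first phase is exactly -1 and the second has angle `(2p +
1)απ`. Since `α` is irrational, the numbers `2pα + 2q` are dense, so they can approach `1 - α`,
which sends the second phase to -1. -/
theorem hasPGST_apex_of_irrational (hk0 : 0 < k) (hirr : Irrational D) :
    HasPGST (blowUp 2 (cone H)) (0, none) (1, none) := by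
  have hkD := lt_of_sq_eq_add Fintype.card_pos hD0 hD2
  have hD : 0 < D := (Nat.cast_nonneg k).trans_lt hkD
  have hkR : (0 : ℝ) < k := by exact_mod_cast hk0
  have hne : (k : ℝ) + D ≠ 0 := by positivity
  set α : ℝ := (k - D) / (k + D) with hα
  have hαirr : Irrational α := by
    rintro ⟨r, hr⟩
    have h1 : (r : ℝ) * (k + D) = k - D := by rw [hr, hα]; field_simp
    -- The value `α = -1` would force `k = 0`.
    have h2 : (1 + r : ℝ) ≠ 0 := fun h => by
      have : (r : ℝ) = -1 := by linarith
      rw [this] at h1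
      linarith
    refine hirr ⟨k * (1 - r) / (1 + r), ?_⟩
    push_cast
    rw [div_eq_iff h2]
    linarith
  have hdense : Dense (AddSubgroup.closure {2 * α, (2 : ℝ)} : Set ℝ) := by
    rw [dense_addSubgroupClosure_pair_iff]
    simpa using hαirr
  obtain ⟨x, hx, hlim⟩ := mem_closure_iff_seq_limit.mp (hdense (1 - α))
  have hx' : ∀ n, ∃ p q : ℤ, p • (2 * α) + q • (2 : ℝ) = x n := fun n =>
    AddSubgroup.mem_closure_pair.mp (hx n)
  choose p q hpq using hx'
  refine ⟨fun n => (2 * p n + 1) * Real.pi / (k + D), ?_⟩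
  have e1 : ∀ n, Complex.exp (I * ((k + D) * ((2 * p n + 1) * Real.pi / (k + D)) : ℝ)) = -1 :=
    fun n => exp_I_mul_eq_neg_one_iff.mpr ⟨p n, by field_simp⟩
  have e2 : ∀ n, Complex.exp (I * ((k - D) * ((2 * p n + 1) * Real.pi / (k + D)) : ℝ))
      = Complex.exp (I * ((α + x n) * Real.pi : ℝ)) := by
    intro n
    rw [Complex.exp_eq_exp_iff_exists_int]
    refine ⟨-q n, ?_⟩
    have h : (k - D) * ((2 * p n + 1) * Real.pi / (k + D)) = (α + x n) * Real.pi
        - 2 * q n * Real.pi := by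
      rw [← hpq n, hα]
      simp only [zsmul_eq_mul]
      field_simp
      ring
    rw [h]
    push_cast
    ring
  simp only [transitionMatrix_blowUp_cone_apex H hk hD.ne' hD2, if_neg zero_ne_one, e1, e2]
  have hF : Continuous fun y : ℝ => ‖((((D - k) / (2 * D) : ℝ) : ℂ) * -1 +
      ((D + k) / (2 * D) : ℝ) * Complex.exp (I * ((α + y) * Real.pi : ℝ)) + -1) / 2‖ := by
    fun_prop
  have h1 : Complex.exp (I * ((α + (1 - α)) * Real.pi : ℝ)) = -1 :=
    exp_I_mul_eq_neg_one_iff.mpr ⟨0, by push_cast; ring⟩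
  have h2 := (hF.tendsto (1 - α)).comp hlim
  have hDC : (D : ℂ) ≠ 0 := by exact_mod_cast hD.ne'
  have h3 : ((((D - k) / (2 * D) : ℝ) : ℂ) * -1 + ((D + k) / (2 * D) : ℝ) * -1 + -1) / 2 = -1 := by
    push_cast
    field_simp
    ring
  rw [h1, h3, norm_neg, norm_one] at h2
  exact h2

end Apex

/-! ### Rationality and 2-adic valuations -/

theorem not_irrational_of_mul_eq_mul_pi {k : ℕ} (hk : 0 < k) {D t : ℝ} (ht : t ≠ 0) {p q : ℤ}
    (hp : k * t = p * Real.pi) (hq : D * t = q * Real.pi) : ¬ Irrational D := by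
  have hkR : (k : ℝ) ≠ 0 := by exact_mod_cast hk.ne'
  have hp0 : (p : ℝ) ≠ 0 := fun h => mul_ne_zero hkR ht (by rw [hp, h, zero_mul])
  refine fun h => h ⟨k * q / p, ?_⟩
  push_cast
  rw [div_eq_iff hp0]
  refine mul_right_cancel₀ (mul_ne_zero ht Real.pi_ne_zero) ?_
  linear_combination (q * Real.pi) * hp - (p * Real.pi) * hq

theorem two_pow_succ_padicValInt_not_dvd {s : ℤ} (hs : s ≠ 0) :
    ¬ (2 : ℤ) ^ (padicValInt 2 s + 1) ∣ s := by
  have h := padicValInt_dvd_iff (p := 2) (padicValInt 2 s + 1) s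
  push_cast at h
  rw [h]
  omega

/-- The case `c = 0` must be excluded: `padicValInt 2 0` is 0, although every power of 2 divides 0.
-/
theorem padicValInt_two_lt_iff {s c : ℤ} (hc : c ≠ 0) :
    padicValInt 2 s < padicValInt 2 c ↔ (2 : ℤ) ^ (padicValInt 2 s + 1) ∣ c := by
  have h := padicValInt_dvd_iff (p := 2) (padicValInt 2 s + 1) c
  push_cast at h
  rw [h]
  omega

theorem isCoprime_two_pow_of_odd {x : ℤ} (hx : Odd x) (n : ℕ) : IsCoprime ((2 : ℤ) ^ n) x := by
  obtain ⟨e, rfl⟩ := hx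
  exact IsCoprime.pow_left ⟨-e, 1, by ring⟩

/-- Dividing by the greatest common divisor turns an inequality of `2`-adic valuations into
parities of the cofactors. -/
theorem exists_even_odd_of_padicValInt_two_lt {s c : ℤ} (hs : s ≠ 0) (hc : c ≠ 0)
    (h : padicValInt 2 s < padicValInt 2 c) :
    ∃ c' s' : ℤ, Even c' ∧ Odd s' ∧ c = Int.gcd c s * c' ∧ s = Int.gcd c s * s' := by
  rw [padicValInt_two_lt_iff hc] at h
  obtain ⟨c', hc'⟩ := Int.gcd_dvd_left c s
  obtain ⟨s', hs'⟩ := Int.gcd_dvd_right c s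
  have hg : (Int.gcd c s : ℤ) ≠ 0 := fun h0 => hc (by rw [hc', h0, zero_mul])
  have heven : Even c' := by
    -- With `c'` odd, the power of 2 dividing `c` would divide the gcd, hence `s`.
    by_contra hodd
    rw [Int.not_even_iff_odd] at hodd
    rw [hc'] at h
    exact two_pow_succ_padicValInt_not_dvd hs
      (((isCoprime_two_pow_of_odd hodd _).dvd_of_dvd_mul_right h).trans (Int.gcd_dvd_right c s))
  refine ⟨c', s', heven, ?_, hc', hs'⟩
  by_contra hodd
  rw [Int.not_odd_iff_even] at hodd
  -- Two even cofactors would make twice the gcd a common divisor.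
  have h2 : (2 : ℤ) * Int.gcd c s ∣ Int.gcd c s := by
    refine Int.dvd_coe_gcd ?_ ?_
    · conv_rhs => rw [hc']
      rw [mul_comm]
      exact mul_dvd_mul_left _ heven.two_dvd
    · conv_rhs => rw [hs']
      rw [mul_comm]
      exact mul_dvd_mul_left _ hodd.two_dvd
  obtain ⟨e, he⟩ := h2
  have : (Int.gcd c s : ℤ) * (2 * e - 1) = 0 := by linear_combination -he
  rcases mul_eq_zero.mp this with h0 | h0
  · exact hg h0
  · omega

/-! ### Least transfer times, and arithmetic criteria for PST and proper PGST -/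

section Main

variable {W : Type*} [Fintype W] [DecidableEq W] [Nonempty W] (H : SimpleGraph W)
  [DecidableRel H.Adj] {k : ℕ} (hk : H.IsRegularOfDegree k)

include hk

theorem isLeast_hasPSTAt_apex_of_degree_zero (hk0 : k = 0) :
    IsLeast {τ : ℝ | HasPSTAt (blowUp 2 (cone H)) (0, none) (1, none) τ}
      (Real.pi / (2 * √(Fintype.card W : ℝ))) := by
  have hm : (0 : ℝ) < Fintype.card W := by exact_mod_cast Fintype.card_pos
  have hD : 0 < 2 * √(Fintype.card W : ℝ) := by positivity
  have hD2 : (2 * √(Fintype.card W : ℝ)) ^ 2 = (k : ℝ) ^ 2 + 4 * Fintype.card W := by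
    rw [mul_pow, Real.sq_sqrt hm.le, hk0]
    norm_num
  have hiff := fun t => hasPSTAt_apex_iff H hk hD.le hD2 (t := t)
  subst hk0
  refine ⟨(hiff _).mpr ⟨by positivity, ⟨0, ?_⟩, ⟨-1, ?_⟩⟩, fun t ht => ?_⟩
  · push_cast
    field_simp
    ring
  · push_cast
    field_simp
    ring
  · obtain ⟨ht0, ⟨n, hn⟩, -⟩ := (hiff t).mp ht
    rw [Nat.cast_zero, zero_add] at hn
    have hn0 : (0 : ℝ) < 2 * n + 1 :=
      pos_of_mul_pos_left (hn ▸ mul_pos hD ht0) Real.pi_pos.le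
    have hn1 : (0 : ℤ) < 2 * n + 1 := by exact_mod_cast hn0
    have hn2 : (1 : ℝ) ≤ 2 * n + 1 := by exact_mod_cast hn1
    rw [div_le_iff₀ hD, mul_comm t, hn]
    exact le_mul_of_one_le_left Real.pi_pos.le hn2

theorem isLeast_hasPSTAt_apex_of_padicValInt_lt (hk0 : 0 < k) {s : ℤ}
    (hs : 4 * (Fintype.card W : ℤ) = s * (2 * k + s))
    (hv : padicValInt 2 s < padicValInt 2 (2 * (k : ℤ))) :
    IsLeast {τ : ℝ | HasPSTAt (blowUp 2 (cone H)) (0, none) (1, none) τ}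
      (Real.pi / (Int.gcd (2 * (k : ℤ)) s : ℝ)) := by
  have hm : (0 : ℤ) < Fintype.card W := by exact_mod_cast Fintype.card_pos
  have hs0 : s ≠ 0 := by
    rintro rfl
    omega
  have hc0 : (2 * (k : ℤ)) ≠ 0 := by omega
  have hsR : 4 * (Fintype.card W : ℝ) = s * (2 * k + s) := by exact_mod_cast hs
  have hiff : ∀ t, HasPSTAt (blowUp 2 (cone H)) (0, none) (1, none) t ↔
      0 < t ∧ (∃ n : ℤ, (2 * k + s) * t = (2 * n + 1) * Real.pi) ∧
        ∃ n : ℤ, -s * t = (2 * n + 1) * Real.pi := by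
    intro t
    -- Here `s` may be either root of `s ^ 2 + 2ks = 4m`; the sign of `k + s` only swaps the two
    -- conditions.
    rw [hasPSTAt_apex_iff H hk (D := |(k : ℝ) + s|) (abs_nonneg _)
      (by rw [sq_abs]; linear_combination -hsR)]
    rcases abs_choice ((k : ℝ) + s) with h | h <;> rw [h]
    · have e1 : (k : ℝ) + (k + s) = 2 * k + s := by ring
      have e2 : (k : ℝ) - (k + s) = -s := by ring
      rw [e1, e2]
    · have e1 : (k : ℝ) + -(k + s) = -s := by ring
      have e2 : (k : ℝ) - -(k + s) = 2 * k + s := by ring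
      rw [e1, e2, and_comm (a := ∃ n : ℤ, -(s : ℝ) * t = _)]
  obtain ⟨c', s', ⟨c'', hc''⟩, ⟨s'', hs''⟩, hc', hs'⟩ :=
    exists_even_odd_of_padicValInt_two_lt hs0 hc0 hv
  have hb := Int.gcd_eq_gcd_ab (2 * (k : ℤ)) s
  have hgpos : 0 < Int.gcd (2 * (k : ℤ)) s := Int.gcd_pos_of_ne_zero_right _ hs0
  set g := Int.gcd (2 * (k : ℤ)) s
  have hgR : (0 : ℝ) < g := by exact_mod_cast hgpos
  have hcR : 2 * (k : ℝ) = g * c' := by exact_mod_cast hc'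
  have hsR' : (s : ℝ) = g * s' := by exact_mod_cast hs'
  have hcR'' : (c' : ℝ) = c'' + c'' := by exact_mod_cast hc''
  have hsR'' : (s' : ℝ) = 2 * s'' + 1 := by exact_mod_cast hs''
  refine ⟨(hiff _).mpr ⟨by positivity, ⟨c'' + s'', ?_⟩, ⟨-s'' - 1, ?_⟩⟩, fun t ht => ?_⟩
  · rw [hcR, hsR', hcR'', hsR'']
    push_cast
    field_simp
    ring
  · rw [hsR', hsR'']
    push_cast
    field_simp
    ring
  · obtain ⟨ht0, ⟨n, hn⟩, ⟨l, hl⟩⟩ := (hiff t).mp ht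
    set x := Int.gcdA (2 * (k : ℤ)) s
    set y := Int.gcdB (2 * (k : ℤ)) s
    have hbR : (g : ℝ) = 2 * k * x + s * y := by exact_mod_cast hb
    -- The two conditions give `2kt` and `st` as integer multiples of `π`; Bézout then makes `gt`
    -- one as well, so `t ≥ π / g`.
    set N : ℤ := x * (2 * n + 1 + (2 * l + 1)) - y * (2 * l + 1) with hN
    have hgt : g * t = N * Real.pi := by
      rw [hbR, hN]
      push_cast
      linear_combination (x : ℝ) * hn + (x - y : ℝ) * hl
    have hN0 : (0 : ℝ) < N := pos_of_mul_pos_left (hgt ▸ mul_pos hgR ht0) Real.pi_pos.le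
    have hN1 : (0 : ℤ) < N := by exact_mod_cast hN0
    have hN2 : (1 : ℝ) ≤ N := by exact_mod_cast hN1
    rw [div_le_iff₀ hgR, mul_comm t, hgt]
    exact le_mul_of_one_le_left Real.pi_pos.le hN2

theorem exists_of_hasPSTAt_apex (hk0 : 0 < k) {t : ℝ}
    (ht : HasPSTAt (blowUp 2 (cone H)) (0, none) (1, none) t) :
    ∃ s : ℤ, Even s ∧ 4 * (Fintype.card W : ℤ) = s * (2 * k + s) ∧
      padicValInt 2 s < padicValInt 2 (2 * (k : ℤ)) := by
  have hD2 : (√((k ^ 2 + 4 * Fintype.card W : ℕ) : ℝ)) ^ 2 = k ^ 2 + 4 * Fintype.card W := by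
    rw [Real.sq_sqrt (Nat.cast_nonneg _)]
    push_cast
    rfl
  obtain ⟨ht0, ⟨p, hp⟩, ⟨q, hq⟩⟩ := (hasPSTAt_apex_iff H hk (Real.sqrt_nonneg _) hD2).mp ht
  -- Half the sum and half the difference of the two phase conditions.
  have hirr := not_irrational_of_mul_eq_mul_pi hk0 ht0.ne' (p := p + q + 1) (q := p - q)
    (D := √((k ^ 2 + 4 * Fintype.card W : ℕ) : ℝ))
    (by push_cast at hp hq ⊢; linarith) (by push_cast at hp hq ⊢; linarith)
  rw [irrational_sqrt_natCast_iff, not_not] at hirr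
  obtain ⟨d, hd⟩ := hirr
  rw [hd, Nat.cast_mul, Real.sqrt_mul_self (Nat.cast_nonneg _)] at hp hq
  have hdZ : (k : ℤ) ^ 2 + 4 * Fintype.card W = d * d := by exact_mod_cast hd
  have hc0 : (2 * (k : ℤ)) ≠ 0 := by omega
  refine ⟨d - k, ?_, by linear_combination hdZ, ?_⟩
  · have h : Even ((d : ℤ) * d - k * k) := ⟨2 * Fintype.card W, by linear_combination -hdZ⟩
    simpa [Int.even_sub, Int.even_mul] using h
  · rw [padicValInt_two_lt_iff hc0]
    -- Eliminate `t` between `2kt = 2(p + q + 1)π` and `(d - k)t = -(2q + 1)π`. The left side has an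
    -- extra factor 2, and the odd factor on the right can be cancelled.
    have hrel : ((d : ℤ) - k) * (2 * (p + q + 1)) = 2 * k * -(2 * q + 1) := by
      have : ((d : ℝ) - k) * (2 * (p + q + 1)) = 2 * k * -(2 * q + 1) := by
        refine mul_right_cancel₀ (mul_ne_zero ht0.ne' Real.pi_ne_zero) ?_
        linear_combination (-(d - k) * t) * (hp + hq) - 2 * k * t * hq
      exact_mod_cast this
    refine (isCoprime_two_pow_of_odd (x := -(2 * q + 1)) (Odd.neg ⟨q, rfl⟩) _).dvd_of_dvd_mul_right
      (hrel ▸ ?_)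
    rw [pow_succ]
    have := padicValInt_dvd (p := 2) ((d : ℤ) - k)
    exact mul_dvd_mul (by exact_mod_cast this) (Dvd.intro _ rfl)

theorem hasProperPGST_apex_iff :
    HasProperPGST (blowUp 2 (cone H)) (0, none) (1, none) ↔
      0 < k ∧ ¬ IsSquare (k ^ 2 + 4 * Fintype.card W) := by
  have hD2 : (√((k ^ 2 + 4 * Fintype.card W : ℕ) : ℝ)) ^ 2 = k ^ 2 + 4 * Fintype.card W := by
    rw [Real.sq_sqrt (Nat.cast_nonneg _)]
    push_cast
    rfl
  have hD0 := Real.sqrt_nonneg ((k ^ 2 + 4 * Fintype.card W : ℕ) : ℝ)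
  have hkD := lt_of_sq_eq_add Fintype.card_pos hD0 hD2
  rw [← irrational_sqrt_natCast_iff]
  have hper := isPeriodicAt_apex_iff H hk hD0 hD2
  constructor
  · rintro ⟨-, hnot, -⟩
    rw [hper] at hnot
    refine ⟨Nat.pos_of_ne_zero fun h0 => hnot ?_, ?_⟩
    · have hD := (Nat.cast_nonneg k).trans_lt hkD
      refine ⟨2 * Real.pi / √((k ^ 2 + 4 * Fintype.card W : ℕ) : ℝ), by positivity,
        ⟨1, ?_⟩, ⟨-1, ?_⟩⟩
      · have hk' : (k : ℝ) = 0 := by exact_mod_cast h0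
        rw [hk', zero_add, mul_div_cancel₀ _ hD.ne']
        push_cast
        ring
      · have hk' : (k : ℝ) = 0 := by exact_mod_cast h0
        rw [hk', zero_sub, neg_mul, mul_div_cancel₀ _ hD.ne']
        push_cast
        ring
    · rw [irrational_sqrt_natCast_iff]
      rintro ⟨d, hd⟩
      rw [hd, Nat.cast_mul, Real.sqrt_mul_self (Nat.cast_nonneg _)] at hnot
      -- If `D` is an integer, both frequencies are integers and `2π` is a period.
      exact hnot ⟨2 * Real.pi, by positivity, ⟨k + d, by push_cast; ring⟩,
        ⟨k - d, by push_cast; ring⟩⟩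
  · rintro ⟨hk0, hirr⟩
    have hnp : ∀ i : ZMod 2, ¬ IsPeriodicAt (blowUp 2 (cone H)) (i, none) := by
      intro i
      rw [hper]
      rintro ⟨t, ht0, ⟨p, hp⟩, ⟨q, hq⟩⟩
      exact not_irrational_of_mul_eq_mul_pi hk0 ht0.ne' (p := p + q) (q := p - q)
        (by push_cast at hp hq ⊢; linarith) (by push_cast at hp hq ⊢; linarith) hirr
    exact ⟨hasPGST_apex_of_irrational H hk hD0 hD2 hk0 hirr, hnp 0, hnp 1⟩

end Main

end QuantumWalk

theorem mainTheorem12 {W : Type*} [Fintype W] [DecidableEq W] [Nonempty W]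
    (H : SimpleGraph W) [DecidableRel H.Adj] (k m : ℕ)
    (hk : H.IsRegularOfDegree k) (hm : Fintype.card W = m) :
    -- when perfect state transfer occurs between the two copies of the apex
    (QuantumWalk.HasPST (QuantumWalk.blowUp 2 (QuantumWalk.cone H)) (0, none) (1, none) ↔
      k = 0 ∨
      (0 < k ∧ ∃ s : ℤ, Even s ∧ (m : ℚ) = (s : ℚ) * (2 * (k : ℚ) + (s : ℚ)) / 4 ∧
        padicValInt 2 s < padicValInt 2 (2 * (k : ℤ)))) ∧
    -- the time of perfect state transfer
    (k = 0 →
      IsLeast {τ : ℝ | QuantumWalk.HasPSTAt (QuantumWalk.blowUp 2 (QuantumWalk.cone H))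
        (0, none) (1, none) τ} (Real.pi / (2 * Real.sqrt (m : ℝ)))) ∧
    (0 < k → ∀ s : ℤ, Even s → (m : ℚ) = (s : ℚ) * (2 * (k : ℚ) + (s : ℚ)) / 4 →
      padicValInt 2 s < padicValInt 2 (2 * (k : ℤ)) →
      IsLeast {τ : ℝ | QuantumWalk.HasPSTAt (QuantumWalk.blowUp 2 (QuantumWalk.cone H))
        (0, none) (1, none) τ} (Real.pi / (Int.gcd (2 * (k : ℤ)) s : ℝ))) ∧
    -- when proper pretty good state transfer occurs
    (QuantumWalk.HasProperPGST (QuantumWalk.blowUp 2 (QuantumWalk.cone H))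
        (0, none) (1, none) ↔
      0 < k ∧ ¬ IsSquare (k ^ 2 + 4 * m)) := by
  subst hm
  have hcast : ∀ s : ℤ, ((Fintype.card W : ℕ) : ℚ) = (s : ℚ) * (2 * (k : ℚ) + (s : ℚ)) / 4 ↔
      4 * (Fintype.card W : ℤ) = s * (2 * k + s) := by
    intro s
    rw [eq_div_iff four_ne_zero, mul_comm _ (4 : ℚ)]
    exact_mod_cast Iff.rfl
  simp only [hcast]
  have hzero := fun h => QuantumWalk.isLeast_hasPSTAt_apex_of_degree_zero H hk h
  have hpos := fun (h : 0 < k) (s : ℤ) =>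
    QuantumWalk.isLeast_hasPSTAt_apex_of_padicValInt_lt H hk h (s := s)
  refine ⟨⟨?_, ?_⟩, hzero, fun h s _ => hpos h s, QuantumWalk.hasProperPGST_apex_iff H hk⟩
  · rintro ⟨t, ht⟩
    rcases k.eq_zero_or_pos with h | h
    · exact Or.inl h
    · exact Or.inr ⟨h, QuantumWalk.exists_of_hasPSTAt_apex H hk h ht⟩
  · rintro (h | ⟨h, s, -, hs, hv⟩)
    · exact ⟨_, (hzero h).1⟩
    · exact ⟨_, (hpos h s hs hv).1⟩
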